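/- **Setting.** Let $\Omega\subset\mathbb R^2$ be a bounded convex domain with smooth boundary, and let $\Gamma\subset\Omega$ be a smooth interface of finite length (whose closure meets $\partial\Omega$ in a set of zero length) such that $\Omega\setminus\Gamma$ is the union of two disjoint connected open sets $\Omega_1,\Omega_2$; let $n$ be the unit normal of $\Gamma$ pointing from $\Omega_1$ to $\Omega_2$, and also the outward unit normal of $\partial\Omega$. Let $\partial\Omega=\partial\Omega_p\cup\partial\Omega_u$ be a disjoint splitting. Let $K=\mathrm{diag}(K_1,K_2)$ be a measurable permeability tensor with $K_1,K_2\ge\kappa>0$, $\eta=K^{-1}$, $\eta_\Gamma\in L^1(\Gamma)$, $\xi\in(0,1/4]$, $f,g\in L^2(\Omega_1\cup\Omega_2)$, $p_B\in L^2(\partial\Omega_p)$, $\hat p\in L^2(\Gamma)$, and let $u_B$ be boundary flux data, entering through a linear functional $\varphi\mapsto(u_B,\varphi)_{\partial\Omega_u}$. For pairs $v=(v_1,v_2)$ put $(v,w)_{\Omega_1\cup\Omega_2}=\sum_i(v_i,w_i)_{\Omega_i}$, and on $\Gamma$ put $\{v\cdot n\}=\frac12(v_1+v_2)\cdot n$ and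 $[\![v\cdot n]\!]=(v_1-v_2)\cdot n$. **Mesh and spaces.** Let $\mathcal T_h$ be a finite conforming triangulation (closed triangles) covering $\Omega$, and let $h$ be the piecewise constant function equal to $h_T=\operatorname{diam}T$ on $T$ (on an edge: any value between the diameters of the elements containing that edge). For $i=1,2$ let $\mathcal T_{h,i}=\{T\in\mathcal T_h: T\cap\Omega_i\ne\emptyset\}$, let $\Omega_{\mathcal T_{h,i}}$ be the union of its elements, and let $\mathcal F_{h,i}$ be the set of edges that are shared by two elements of $\mathcal T_{h,i}$ and belong to an element $T\in\mathcal T_h$ with $|\Gamma\cap T|>0$. Let $(\mathbf V_k,\hat k)=(\mathbf{RT}_k,k)$ with $k\ge0$, or $(\mathbf{BDM}_k,k-1)$ with $k\ge1$, where $\mathbf{RT}_k(T)=P_k(T)^2+xP_k(T)$ and $\mathbf{BDM}_k(T)=P_k(T)^2$. Let $$\mathbf V_{k,h}=\{(v_1,v_2): v_i\in \mathbf H^{\mathrm{div}}(\Omega_{\mathcal T_{h,i}}),\ v_i|_T\in\mathbf V_k(T)\ \forall T\in\mathcal T_{h,i}\},\qquad Q_h=\{(q_1,q_2): q_i|_T\in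 P_{\hat k}(T)\ \forall T\in\mathcal T_{h,i}\},$$ and $Q_h^0=\{q\in Q_h:(q,1)_{\Omega_1\cup\Omega_2}=0\}$. **Method 2.** Let $c>0$, $\lambda_u=ch^{-1}$, $\gamma\in[-1,1]$, and let $\tau_u,\tau_b>0$ be parameters which may vary with $i$ and $j$. Put $$s_u(u,v)=\sum_{i=1}^2\sum_{F\in\mathcal F_{h,i}}\sum_{j=0}^{\hat k+1}\tau_u h^{2j+1}([D^j_{n_F}u_i],[D^j_{n_F}v_i])_F,\qquad s_b(u,q)=\sum_{i=1}^2\sum_{F\in\mathcal F_{h,i}}\sum_{j=0}^{\hat k}\tau_b h^{2j+\gamma}([D^j\operatorname{div}u_i],[D^jq_i])_F,$$ where $[\cdot]$ is the jump across $F$, $D^j_{n_F}$ is the $j$-th normal derivative, and $D^j$ is either the $j$-th normal derivative or the tensor of all partial derivatives of order $j$ (the result holds for both). Let $$\mathcal A(u,v)=(\eta u,v)_{\Omega_1\cup\Omega_2}+(\eta_\Gamma\{u\cdot n\},\{v\cdot n\})_\Gamma+(\xi\eta_\Gamma[\![u\cdot n]\!],[\![v\cdot n]\!])_\Gamma+(\lambda_uu\cdot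 n,v\cdot n)_{\partial\Omega_u}+s_u(u,v),$$ $$\mathcal B_0(u,q)=-(\operatorname{div}u,q)_{\Omega_1\cup\Omega_2}-s_b(u,q),\qquad \mathcal B(u,q)=\mathcal B_0(u,q)+(u\cdot n,q)_{\partial\Omega_u},$$ $$\mathcal F_0(v,q)=(f,v)_{\Omega_1\cup\Omega_2}+(\lambda_uu_B,v\cdot n)_{\partial\Omega_u}-(p_B,v\cdot n)_{\partial\Omega_p}-(\hat p,[\![v\cdot n]\!])_\Gamma+(g,q)_{\Omega_1\cup\Omega_2}.$$ A pair $(u_h,p_h)\in\mathbf V_{k,h}\times Q$ solves Method 2 with pressure space $Q$ if $$\mathcal A(u_h,v_h)+\mathcal B(v_h,p_h)-\mathcal B_0(u_h,q_h)=\mathcal F_0(v_h,q_h)\qquad\text{for all }(v_h,q_h)\in\mathbf V_{k,h}\times Q.$$ **Theorem (divergence-free property of Method 2).** Assume $g=0$. 1. If $(u_h,p_h)$ solves Method 2 with $Q=Q_h$, then $\operatorname{div}u_h=0$: for $i=1,2$, $\operatorname{div}u_{h,i}=0$ at every point of every element of $\mathcal T_{h,i}$, and also in the sense of distributions on the interior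 of $\Omega_{\mathcal T_{h,i}}$. 2. If $\partial\Omega_p=\emptyset$ and $(u_h,p_h)$ solves Method 2 with the normalised pressure space $Q=Q_h^0$, then, in the same sense, $\operatorname{div}u_h$ is equal on both active domains to the single constant $(\operatorname{div}u_h,1)_{\Omega_1\cup\Omega_2}/|\Omega_1\cup\Omega_2|$; in particular $\operatorname{div}u_h=0$ if and only if $(\operatorname{div}u_h,1)_{\Omega_1\cup\Omega_2}=0$. -/

import Mathlib

open MeasureTheory
open scoped Topology ContDiff

noncomputable section

namespace CutDarcy

/-- The Euclidean plane. -/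
abbrev Plane : Type := EuclideanSpace ℝ (Fin 2)

/-! ### The domain, the subdomains and the interface -/

/-- `φ` is a smooth function that defines the set `G` near the point `x` of its boundary:
near `x`, the set `G` is `{φ < 0}`, and `φ x = 0`, `∇φ x ≠ 0`. -/
def IsLocalDefiningFunction (G : Set Plane) (x : Plane) (φ : Plane → ℝ) : Prop :=
  ContDiff ℝ ∞ φ ∧ φ x = 0 ∧ gradient φ x ≠ 0 ∧ ∀ᶠ y in 𝓝 x, (y ∈ G ↔ φ y < 0)

open Classical in
/-- The unit normal at `x` that points out of `G` (zero where `G` is not smoothly bounded). -/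
def outerNormal (G : Set Plane) (x : Plane) : Plane :=
  if h : ∃ φ, IsLocalDefiningFunction G x φ then
    ‖gradient h.choose x‖⁻¹ • gradient h.choose x
  else 0

/-- A bounded convex domain `Ω` with smooth boundary, split by a smooth interface `Γ` of finite
length into two disjoint connected open subdomains `sub 0` and `sub 1`
(these are `Ω₁` and `Ω₂`). -/
structure Geometry where
  Ω : Set Plane
  sub : Fin 2 → Set Plane
  Γ : Set Plane
  isOpen_Ω : IsOpen Ω
  convex_Ω : Convex ℝ Ω
  bounded_Ω : Bornology.IsBounded Ω
  smooth_boundary : ∀ x ∈ frontier Ω, ∃ φ, IsLocalDefiningFunction Ω x φ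
  isOpen_sub : ∀ i, IsOpen (sub i)
  isConnected_sub : ∀ i, IsConnected (sub i)
  disjoint_sub : Disjoint (sub 0) (sub 1)
  disjoint_interface : ∀ i, Disjoint (sub i) Γ
  union_eq : sub 0 ∪ sub 1 ∪ Γ = Ω
  smooth_interface : ∀ x ∈ Γ, ∃ φ : Plane → ℝ, ContDiff ℝ ∞ φ ∧ φ x = 0 ∧ gradient φ x ≠ 0 ∧
    ∀ᶠ y in 𝓝 x, (y ∈ sub 0 ↔ φ y < 0) ∧ (y ∈ sub 1 ↔ 0 < φ y)
  finite_length : μH[1] Γ < ⊤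
  interface_boundary_null : μH[1] (closure Γ ∩ frontier Ω) = 0

/-- The union of the two open subdomains. -/
def Geometry.subUnion (G : Geometry) : Set Plane := G.sub 0 ∪ G.sub 1

/-- The unit normal of the interface that points from `Ω₁` into `Ω₂`. -/
def Geometry.interfaceNormal (G : Geometry) (x : Plane) : Plane := outerNormal (G.sub 0) x

/-- The outward unit normal of the outer boundary. -/
def Geometry.boundaryNormal (G : Geometry) (x : Plane) : Plane := outerNormal G.Ω x

/-! ### The background mesh, the active meshes and the ghost-penalty faces -/

/-- A finite conforming triangulation whose triangles cover `Ω`. -/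
structure BackgroundMesh (G : Geometry) where
  complex : Geometry.SimplicialComplex ℝ Plane
  finite : complex.faces.Finite
  pure : ∀ s ∈ complex.faces, ∃ t ∈ complex.faces, s ⊆ t ∧ t.card = 3
  covers : G.Ω ⊆ complex.space

/-- The closed triangle (or edge) with the given set of vertices. -/
def hull (T : Finset Plane) : Set Plane := convexHull ℝ (T : Set Plane)

/-- The diameter `h_T` of an element. -/
def diam (T : Finset Plane) : ℝ := Metric.diam (hull T)

variable {G : Geometry}

open Classical in
/-- The triangles of the background mesh, each given by its three vertices. -/
def BackgroundMesh.elements (M : BackgroundMesh G) : Finset (Finset Plane) :=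
  M.finite.toFinset.filter fun t => t.card = 3

open Classical in
/-- The elements of the active mesh of `Ω_i`: those that meet `Ω_i`. -/
def BackgroundMesh.active (M : BackgroundMesh G) (i : Fin 2) : Finset (Finset Plane) :=
  M.elements.filter fun T => (hull T ∩ G.sub i).Nonempty

/-- The active domain: the union of the closed elements of the active mesh. -/
def BackgroundMesh.activeDomain (M : BackgroundMesh G) (i : Fin 2) : Set Plane :=
  ⋃ T ∈ M.active i, hull T

open Classical in
/-- The elements that are cut by the interface in a set of positive length. -/
def BackgroundMesh.cutElements (M : BackgroundMesh G) : Finset (Finset Plane) :=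
  M.elements.filter fun T => 0 < μH[1] (G.Γ ∩ hull T)

/-- `(T₁, T₂)` are two different elements of the active mesh of `Ω_i` that share the edge `F`. -/
def BackgroundMesh.SharedBy (M : BackgroundMesh G) (i : Fin 2) (F : Finset Plane)
    (P : Finset Plane × Finset Plane) : Prop :=
  P.1 ∈ M.active i ∧ P.2 ∈ M.active i ∧ P.1 ≠ P.2 ∧ F ⊆ P.1 ∧ F ⊆ P.2

open Classical in
/-- The edges of cut elements that are shared by two elements of the active mesh of `Ω_i`. -/
def BackgroundMesh.ghostFaces (M : BackgroundMesh G) (i : Fin 2) : Finset (Finset Plane) :=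
  M.finite.toFinset.filter fun F =>
    F.card = 2 ∧ (∃ T ∈ M.cutElements, F ⊆ T) ∧ ∃ P, M.SharedBy i F P

/-- The two elements of the active mesh that share the edge `F`, in some order. -/
def BackgroundMesh.neighbours (M : BackgroundMesh G) (i : Fin 2) (F : Finset Plane) :
    Finset Plane × Finset Plane :=
  Classical.epsilon (M.SharedBy i F)

/-- A unit normal of the edge `F`. -/
def edgeNormal (F : Finset Plane) : Plane :=
  Classical.epsilon fun ν => ‖ν‖ = 1 ∧ ∀ a ∈ F, ∀ b ∈ F, inner ℝ ν (b - a) = 0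

/-! ### Polynomials and broken polynomials -/

/-- Polynomials in the two coordinates of the plane. -/
abbrev Poly : Type := MvPolynomial (Fin 2) ℝ

/-- Polynomial vector fields. -/
abbrev VecPoly : Type := Fin 2 → Poly

/-- The value of a polynomial at a point. -/
def ev (q : Poly) (x : Plane) : ℝ := MvPolynomial.eval (fun l => x l) q

/-- The value of a polynomial vector field at a point. -/
def vev (v : VecPoly) (x : Plane) : Plane := WithLp.toLp 2 fun l => ev (v l) x

/-- The divergence of a polynomial vector field. -/
def pdiv (v : VecPoly) : Poly := ∑ l, MvPolynomial.pderiv l (v l)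

/-- The derivative of a polynomial in the direction `ν`. -/
def dirDeriv (ν : Plane) (q : Poly) : Poly := ∑ l, MvPolynomial.C (ν l) * MvPolynomial.pderiv l q

/-- The partial derivative of order `j` along the coordinates `s 0, …, s (j-1)`. -/
def partialDeriv {j : ℕ} (s : Fin j → Fin 2) (q : Poly) : Poly :=
  (List.ofFn s).foldr (fun l r => MvPolynomial.pderiv l r) q

/-- The space of polynomials of total degree at most `m`. -/
def P (m : ℕ) : Submodule ℝ Poly := MvPolynomial.restrictTotalDegree (Fin 2) ℝ m

/-- A pair `(q₁, q₂)` of broken polynomials: one polynomial for every subdomain and every element.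
Only elements of the respective active mesh matter. -/
abbrev BrokenPair : Type := Fin 2 → Finset Plane → Poly

/-- A pair `(v₁, v₂)` of broken polynomial vector fields. -/
abbrev BrokenVecPair : Type := Fin 2 → Finset Plane → VecPoly

/-- The elementwise divergence. -/
def brokenDiv (v : BrokenVecPair) : BrokenPair := fun i T => pdiv (v i T)

open Classical in
/-- The function on the active domain that a broken polynomial represents
(set to zero on the edges, which are null sets). -/
def BackgroundMesh.fn (M : BackgroundMesh G) (q : BrokenPair) (i : Fin 2) (x : Plane) : ℝ :=
  ∑ T ∈ M.active i, (interior (hull T)).indicator (ev (q i T)) x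

open Classical in
/-- The vector field on the active domain that a broken polynomial vector field represents. -/
def BackgroundMesh.vfn (M : BackgroundMesh G) (v : BrokenVecPair) (i : Fin 2) (x : Plane) :
    Plane :=
  ∑ T ∈ M.active i, (interior (hull T)).indicator (vev (v i T)) x

/-! ### The space `H^div` -/

/-- `d` is the divergence of `w` on the open set `U` in the sense of distributions. -/
def IsWeakDiv (U : Set Plane) (w : Plane → Plane) (d : Plane → ℝ) : Prop :=
  ∀ φ : Plane → ℝ, ContDiff ℝ ∞ φ → HasCompactSupport φ → tsupport φ ⊆ U →
    ∫ x in U, inner ℝ (w x) (gradient φ x) = -∫ x in U, d x * φ x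

/-- `w ∈ H^div(U)`: both `w` and its weak divergence are square integrable. -/
def MemHdiv (U : Set Plane) (w : Plane → Plane) : Prop :=
  MemLp w 2 (volume.restrict U) ∧ ∃ d, MemLp d 2 (volume.restrict U) ∧ IsWeakDiv U w d

/-! ### The finite element spaces -/

/-- The Raviart-Thomas or the Brezzi-Douglas-Marini family. -/
inductive Family where
  | RT
  | BDM

/-- The local space `V_k(T)`: `(P_k)² + x P_k` for `RT_k` and `(P_k)²` for `BDM_k`. -/
def Family.localSpace (fam : Family) (k : ℕ) : Set VecPoly :=
  match fam with
  | .RT => {v | ∃ a : VecPoly, (∀ l, a l ∈ P k) ∧ ∃ b ∈ P k, ∀ l, v l = a l + MvPolynomial.X l * b}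
  | .BDM => {v | ∀ l, v l ∈ P k}

/-- The indices `k` for which the element pair is defined: `k ≥ 0` for `RT_k × P_k` and
`k ≥ 1` for `BDM_k × P_{k-1}`. -/
def Family.Admissible (fam : Family) (k : ℕ) : Prop :=
  match fam with
  | .RT => True
  | .BDM => 1 ≤ k

/-- The degree of the pressure space that belongs to `V_k`. -/
def Family.pressureDegree (fam : Family) (k : ℕ) : ℕ :=
  match fam with
  | .RT => k
  | .BDM => k - 1

/-- The velocity space: pairs of `H^div`-conforming fields on the two active domains which belong
to `V_k(T)` on every active element. -/
def velocitySpace (M : BackgroundMesh G) (fam : Family) (k : ℕ) : Set BrokenVecPair :=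
  {v | ∀ i, (∀ T ∈ M.active i, v i T ∈ fam.localSpace k) ∧ (∀ T ∉ M.active i, v i T = 0) ∧
    MemHdiv (interior (M.activeDomain i)) (M.vfn v i)}

/-- The pressure space: pairs of discontinuous piecewise polynomials on the two active meshes. -/
def pressureSpace (M : BackgroundMesh G) (m : ℕ) : Set BrokenPair :=
  {q | ∀ i, (∀ T ∈ M.active i, q i T ∈ P m) ∧ ∀ T ∉ M.active i, q i T = 0}

/-- The integral of a pair over `Ω₁ ∪ Ω₂`, i.e. `(q, 1)_{Ω₁ ∪ Ω₂}`. -/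
def total (M : BackgroundMesh G) (q : BrokenPair) : ℝ :=
  ∑ i, ∫ x in G.sub i, M.fn q i x

/-- The pressure space with the normalisation `(q, 1)_{Ω₁ ∪ Ω₂} = 0`. -/
def zeroMeanPressureSpace (M : BackgroundMesh G) (m : ℕ) : Set BrokenPair :=
  {q | q ∈ pressureSpace M m ∧ total M q = 0}

/-! ### Traces -/

/-- `T` is an active element of `Ω_i` that contains points of `Ω_i` arbitrarily close to `x`. -/
def BackgroundMesh.IsTraceElement (M : BackgroundMesh G) (i : Fin 2) (x : Plane)
    (T : Finset Plane) : Prop :=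
  T ∈ M.active i ∧ x ∈ closure (interior (hull T) ∩ G.sub i)

/-- The element from which traces at a point `x` of the boundary of `Ω_i` are taken. -/
def BackgroundMesh.traceElement (M : BackgroundMesh G) (i : Fin 2) (x : Plane) : Finset Plane :=
  Classical.epsilon (M.IsTraceElement i x)

open Classical in
/-- The index of the subdomain that a point `x` of the outer boundary belongs to. -/
def Geometry.side (G : Geometry) (x : Plane) : Fin 2 := if x ∈ closure (G.sub 0) then 0 else 1

/-- The trace of `v_i · n` on the interface. -/
def interfaceTrace (M : BackgroundMesh G) (v : BrokenVecPair) (i : Fin 2) (x : Plane) : ℝ :=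
  inner ℝ (vev (v i (M.traceElement i x)) x) (G.interfaceNormal x)

/-- The average `{v · n}` on the interface. -/
def avgNormal (M : BackgroundMesh G) (v : BrokenVecPair) (x : Plane) : ℝ :=
  (1 / 2) * (interfaceTrace M v 0 x + interfaceTrace M v 1 x)

/-- The jump `⟦v · n⟧` across the interface. -/
def jumpNormal (M : BackgroundMesh G) (v : BrokenVecPair) (x : Plane) : ℝ :=
  interfaceTrace M v 0 x - interfaceTrace M v 1 x

/-- The element from which traces at a point `x` of the outer boundary are taken. -/
def BackgroundMesh.boundaryElement (M : BackgroundMesh G) (x : Plane) : Finset Plane :=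
  M.traceElement (G.side x) x

/-- The trace of `v · n` on the outer boundary. -/
def boundaryNormalTrace (M : BackgroundMesh G) (v : BrokenVecPair) (x : Plane) : ℝ :=
  inner ℝ (vev (v (G.side x) (M.boundaryElement x)) x) (G.boundaryNormal x)

/-- The trace of `q` on the outer boundary. -/
def boundaryTrace (M : BackgroundMesh G) (q : BrokenPair) (x : Plane) : ℝ :=
  ev (q (G.side x) (M.boundaryElement x)) x

/-! ### The data of the Darcy interface problem -/

/-- Coefficients, right-hand sides and boundary data. `K x 0`, `K x 1` are the diagonal entries of
the permeability tensor. The flux datum `uB` is given through its duality pairing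
`φ ↦ (uB, φ)_{∂Ω_u}`, which may be any linear functional: it need not be a function. -/
structure DarcyData (G : Geometry) where
  bdryP : Set Plane
  bdryU : Set Plane
  measurable_bdryP : MeasurableSet bdryP
  measurable_bdryU : MeasurableSet bdryU
  bdry_union : bdryP ∪ bdryU = frontier G.Ω
  bdry_disjoint : Disjoint bdryP bdryU
  K : Plane → Fin 2 → ℝ
  K_measurable : ∀ l, AEMeasurable (fun x => K x l) (volume.restrict G.subUnion)
  K_bound : ∃ κ > 0, ∀ x ∈ G.subUnion, ∀ l, κ ≤ K x l
  ηΓ : Plane → ℝ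
  ηΓ_integrable : IntegrableOn ηΓ G.Γ μH[1]
  ξ : ℝ
  ξ_pos : 0 < ξ
  ξ_le : ξ ≤ 1 / 4
  f : Plane → Plane
  f_memLp : MemLp f 2 (volume.restrict G.subUnion)
  g : Plane → ℝ
  g_memLp : MemLp g 2 (volume.restrict G.subUnion)
  pB : Plane → ℝ
  pB_memLp : MemLp pB 2 (μH[1].restrict bdryP)
  pHat : Plane → ℝ
  pHat_memLp : MemLp pHat 2 (μH[1].restrict G.Γ)
  uB : (bdryU → ℝ) →ₗ[ℝ] ℝ

/-! ### The parameters of the method -/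

/-- The reading of `D^j` in the pressure-type ghost penalty: the `j`-th normal derivative across
the face, or the tensor of all partial derivatives of order `j`. -/
inductive GhostDerivative where
  | normal
  | full

/-- Penalty and stabilisation parameters. `hF F` is the value used on the face `F` for the
elementwise constant mesh function `h`: it lies between diameters of elements that contain `F`. -/
structure MethodParams (M : BackgroundMesh G) where
  c : ℝ
  c_pos : 0 < c
  γ : ℝ
  γ_mem : γ ∈ Set.Icc (-1 : ℝ) 1
  τu : Fin 2 → ℕ → ℝ
  τu_pos : ∀ i j, 0 < τu i j
  τb : Fin 2 → ℕ → ℝ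
  τb_pos : ∀ i j, 0 < τb i j
  hF : Finset Plane → ℝ
  hF_between : ∀ i, ∀ F ∈ M.ghostFaces i, ∃ T ∈ M.elements, ∃ T' ∈ M.elements,
    F ⊆ T ∧ F ⊆ T' ∧ diam T ≤ hF F ∧ hF F ≤ diam T'
  deriv : GhostDerivative

/-- The boundary penalty `λ_u = c h⁻¹`. -/
def lam (M : BackgroundMesh G) (S : MethodParams M) (x : Plane) : ℝ :=
  S.c * (diam (M.boundaryElement x))⁻¹

/-! ### The forms -/

/-- The polynomial that extends the jump of `q_i` across the face `F`. -/
def faceJump (M : BackgroundMesh G) (q : BrokenPair) (i : Fin 2) (F : Finset Plane) : Poly :=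
  q i (M.neighbours i F).1 - q i (M.neighbours i F).2

/-- `([D^j q_i], [D^j r_i])_F` with normal derivatives. -/
def normalJumpProduct (M : BackgroundMesh G) (q r : BrokenPair) (i : Fin 2) (F : Finset Plane)
    (j : ℕ) : ℝ :=
  ∫ x in hull F, ev ((dirDeriv (edgeNormal F))^[j] (faceJump M q i F)) x *
    ev ((dirDeriv (edgeNormal F))^[j] (faceJump M r i F)) x ∂μH[1]

/-- `([D^j q_i], [D^j r_i])_F` with all partial derivatives of order `j`. -/
def fullJumpProduct (M : BackgroundMesh G) (q r : BrokenPair) (i : Fin 2) (F : Finset Plane)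
    (j : ℕ) : ℝ :=
  ∑ s : Fin j → Fin 2, ∫ x in hull F, ev (partialDeriv s (faceJump M q i F)) x *
    ev (partialDeriv s (faceJump M r i F)) x ∂μH[1]

/-- `([D^j q_i], [D^j r_i])_F` in the chosen reading. -/
def jumpProduct (M : BackgroundMesh G) (S : MethodParams M) (q r : BrokenPair) (i : Fin 2)
    (F : Finset Plane) (j : ℕ) : ℝ :=
  match S.deriv with
  | .normal => normalJumpProduct M q r i F j
  | .full => fullJumpProduct M q r i F j

/-- The ghost penalty `s_u` of the velocity; `m` is the degree of the pressure space. -/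
def sU (M : BackgroundMesh G) (S : MethodParams M) (m : ℕ) (u v : BrokenVecPair) : ℝ :=
  ∑ i, ∑ F ∈ M.ghostFaces i, ∑ j ∈ Finset.range (m + 2),
    S.τu i j * S.hF F ^ (2 * j + 1) *
      ∑ l, normalJumpProduct M (fun i T => u i T l) (fun i T => v i T l) i F j

/-- The mixed ghost penalty `s_b`. -/
def sB (M : BackgroundMesh G) (S : MethodParams M) (m : ℕ) (u : BrokenVecPair)
    (q : BrokenPair) : ℝ :=
  ∑ i, ∑ F ∈ M.ghostFaces i, ∑ j ∈ Finset.range (m + 1),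
    S.τb i j * S.hF F ^ (2 * (j : ℝ) + S.γ) * jumpProduct M S (brokenDiv u) q i F j

/-- The form `a`. -/
def aForm (M : BackgroundMesh G) (D : DarcyData G) (S : MethodParams M)
    (u v : BrokenVecPair) : ℝ :=
  (∑ i, ∫ x in G.sub i, ∑ l, (D.K x l)⁻¹ * M.vfn u i x l * M.vfn v i x l)
  + (∫ x in G.Γ, D.ηΓ x * avgNormal M u x * avgNormal M v x ∂μH[1])
  + (∫ x in G.Γ, D.ξ * D.ηΓ x * jumpNormal M u x * jumpNormal M v x ∂μH[1])
  + ∫ x in D.bdryU, lam M S x * boundaryNormalTrace M u x * boundaryNormalTrace M v x ∂μH[1]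

/-- The form `b₀(v, q) = -(div v, q)_{Ω₁ ∪ Ω₂}`. -/
def b0Form (M : BackgroundMesh G) (v : BrokenVecPair) (q : BrokenPair) : ℝ :=
  -∑ i, ∫ x in G.sub i, M.fn (brokenDiv v) i x * M.fn q i x

/-- The form `b(v, q) = -(div v, q)_{Ω₁ ∪ Ω₂} + (v · n, q)_{∂Ω_u}`. -/
def bForm (M : BackgroundMesh G) (D : DarcyData G) (v : BrokenVecPair) (q : BrokenPair) : ℝ :=
  b0Form M v q + ∫ x in D.bdryU, boundaryNormalTrace M v x * boundaryTrace M q x ∂μH[1]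

/-- The form `𝒜 = a + s_u`. -/
def AForm (M : BackgroundMesh G) (D : DarcyData G) (S : MethodParams M) (m : ℕ)
    (u v : BrokenVecPair) : ℝ :=
  aForm M D S u v + sU M S m u v

/-- The form `ℬ = b - s_b`. -/
def BForm (M : BackgroundMesh G) (D : DarcyData G) (S : MethodParams M) (m : ℕ)
    (v : BrokenVecPair) (q : BrokenPair) : ℝ :=
  bForm M D v q - sB M S m v q

/-- The form `ℬ₀ = b₀ - s_b`. -/
def B0Form (M : BackgroundMesh G) (S : MethodParams M) (m : ℕ)
    (v : BrokenVecPair) (q : BrokenPair) : ℝ :=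
  b0Form M v q - sB M S m v q

/-- The right-hand side `ℱ₀`. -/
def F0Form (M : BackgroundMesh G) (D : DarcyData G) (S : MethodParams M)
    (v : BrokenVecPair) (q : BrokenPair) : ℝ :=
  (∑ i, ∫ x in G.sub i, inner ℝ (D.f x) (M.vfn v i x))
  + D.uB (fun x => lam M S x * boundaryNormalTrace M v x)
  - (∫ x in D.bdryP, D.pB x * boundaryNormalTrace M v x ∂μH[1])
  - (∫ x in G.Γ, D.pHat x * jumpNormal M v x ∂μH[1])
  + ∑ i, ∫ x in G.sub i, D.g x * M.fn q i x

/-- `(u, p)` solves Method 2 with trial and test spaces `V × Q`; `m` is the degree of the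
pressure space. -/
def SolvesMethodTwo (M : BackgroundMesh G) (D : DarcyData G) (S : MethodParams M) (m : ℕ)
    (V : Set BrokenVecPair) (Q : Set BrokenPair) (u : BrokenVecPair) (p : BrokenPair) : Prop :=
  u ∈ V ∧ p ∈ Q ∧ ∀ v ∈ V, ∀ q ∈ Q,
    AForm M D S m u v + BForm M D S m v p - B0Form M S m u q = F0Form M D S v q

/-- `div u = c` on both active domains: at every point of every active element, and in the sense
of distributions on the whole active domain. -/
def DivEq (M : BackgroundMesh G) (u : BrokenVecPair) (c : ℝ) : Prop :=
  ∀ i, (∀ T ∈ M.active i, ∀ x ∈ hull T, ev (pdiv (u i T)) x = c) ∧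
    IsWeakDiv (interior (M.activeDomain i)) (M.vfn u i) fun _ => c

end CutDarcy

end

noncomputable section

namespace CutDarcy

variable {G : Geometry}

/-! ### Polynomials as functions on the plane -/

/-! The velocity test function 0 is admissible, and with it every term of the method carrying a
factor `v` disappears. Since `g = 0`, what remains is `ℬ₀(u, q) = 0` for all admissible `q`
(`SolvesMethodTwo.B0Form_eq_zero`), that is, `(div u, q) + s_b(u, q) = 0`. The form `ℬ₀` has no term
on the outer boundary, so only the volume pairing and the ghost penalty have to be controlled.

The divergence maps the local velocity space into the local pressure space (`pdiv_mem_P`), so `q =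
div u - c` can be used as a test function. Constants have no jumps, hence `s_b(u, q)` is a sum of
weighted squares (`sB_shiftedDiv_nonneg`), while `(div u, q) = ‖q‖² + c (q, 1)`. If `c (q, 1) = 0`,
then `‖q‖ = 0` on both subdomains. This covers `c = 0`, and also the mean of `div u`, for which `q`
has zero mean and belongs to the normalised space.

The norm only sees the physical subdomains, whereas the claim concerns whole active elements. Each
active element meets its subdomain in a nonempty open set, and a polynomial vanishing there vanishes
identically (`ev_pdiv_eq_of_B0Form_eq_zero`). Finally, `H^div` conformity supplies a square
integrable weak divergence. It agrees with the elementwise one inside each element, and the edges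
are null sets (`isWeakDiv_const`). -/

@[simp] lemma ev_zero (x : Plane) : ev 0 x = 0 := by simp [ev]

@[simp] lemma ev_C (c : ℝ) (x : Plane) : ev (MvPolynomial.C c) x = c := by simp [ev]

@[simp] lemma ev_sub (q r : Poly) (x : Plane) : ev (q - r) x = ev q x - ev r x := by simp [ev]

lemma analyticOnNhd_ev (q : Poly) : AnalyticOnNhd ℝ (ev q) Set.univ := by
  have h := AnalyticOnNhd.aeval_mvPolynomial (𝕜 := ℝ) (A := ℝ) (s := Set.univ)
    (f := fun (x : Plane) (l : Fin 2) => x l)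
    (fun l x _ => (EuclideanSpace.proj (𝕜 := ℝ) l).analyticAt x) q
  convert! h using 1

lemma contDiff_ev (q : Poly) : ContDiff ℝ ∞ (ev q) :=
  (analyticOnNhd_ev q).contDiff

@[fun_prop]
lemma continuous_ev (q : Poly) : Continuous (ev q) := (contDiff_ev q).continuous

@[fun_prop]
lemma differentiable_ev (q : Poly) : Differentiable ℝ (ev q) :=
  (contDiff_ev q).differentiable (by simp)

/-- A polynomial that vanishes on a nonempty open set vanishes everywhere. -/
lemma ev_eq_zero_of_eqOn_open (q : Poly) {U : Set Plane} (hU : IsOpen U) (hne : U.Nonempty)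
    (h : ∀ x ∈ U, ev q x = 0) (x : Plane) : ev q x = 0 := by
  obtain ⟨y, hy⟩ := hne
  have := (analyticOnNhd_ev q).eq_of_eventuallyEq (g := fun _ => 0) analyticOnNhd_const
    (z₀ := y) (by filter_upwards [hU.mem_nhds hy] with z hz using h z hz)
  exact congrFun this x

/-- Links the formal derivative used for degree counts and `pdiv` with the analytic one needed for
integration by parts. -/
lemma fderiv_ev (q : Poly) (x : Plane) (l : Fin 2) :
    fderiv ℝ (ev q) x (EuclideanSpace.single l 1) = ev (MvPolynomial.pderiv l q) x := by
  induction q using MvPolynomial.induction_on with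
  | C a =>
    have : ev (MvPolynomial.C a) = fun _ => a := funext fun y => ev_C a y
    simp [this]
  | add p q hp hq =>
    have : ev (p + q) = fun y => ev p y + ev q y := funext fun y => by simp [ev]
    rw [this, fderiv_fun_add (by fun_prop) (by fun_prop)]
    simp [hp, hq, ev]
  | mul_X p m hp =>
    have h1 : ev (p * MvPolynomial.X m) = fun y => ev p y * EuclideanSpace.proj (𝕜 := ℝ) m y :=
      funext fun y => by simp [ev]
    rw [h1, fderiv_fun_mul (by fun_prop) (by fun_prop), ContinuousLinearMap.fderiv]
    simp only [add_apply, smul_apply, hp]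
    by_cases h : m = l
    · subst h
      simp [ev]
    · simp [ev, h, MvPolynomial.pderiv_X_of_ne h]

lemma vev_eq_sum (v : VecPoly) (x : Plane) :
    vev v x = ∑ l, ev (v l) x • EuclideanSpace.single l (1 : ℝ) := by
  ext l
  fin_cases l <;> simp [vev]

/-- Integration by parts against a test function. -/
lemma integral_inner_vev_gradient (v : VecPoly) {φ : Plane → ℝ} (hφ : ContDiff ℝ ∞ φ)
    (hc : HasCompactSupport φ) :
    ∫ x, inner ℝ (vev v x) (gradient φ x) = -∫ x, ev (pdiv v) x * φ x := by
  have hφ' : ∀ e, Continuous fun x => fderiv ℝ φ x e := fun e =>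
    (hφ.continuous_fderiv (by simp)).clm_apply continuous_const
  have hc' : ∀ e, HasCompactSupport fun x => fderiv ℝ φ x e := fun e =>
    hc.fderiv_apply (𝕜 := ℝ) (v := e)
  have h1 : ∀ l, Integrable fun x : Plane =>
      ev (v l) x * fderiv ℝ φ x (EuclideanSpace.single l 1) := fun l =>
    ((continuous_ev _).mul (hφ' _)).integrable_of_hasCompactSupport ((hc' _).mul_left)
  have h2 : ∀ q, Integrable fun x : Plane => ev q x * φ x := fun q =>
    ((continuous_ev _).mul hφ.continuous).integrable_of_hasCompactSupport hc.mul_left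
  have h3 : ∀ x, inner ℝ (vev v x) (gradient φ x) =
      ∑ l, ev (v l) x * fderiv ℝ φ x (EuclideanSpace.single l 1) := fun x => by
    rw [inner_gradient_right, vev_eq_sum]
    simp
  have h4 : ∀ x, ev (pdiv v) x * φ x = ∑ l, ev (MvPolynomial.pderiv l (v l)) x * φ x :=
    fun x => by simp only [pdiv, ev, map_sum, Finset.sum_mul]
  simp_rw [h3, h4]
  rw [integral_finsetSum _ fun l _ => h1 l, integral_finsetSum _ fun l _ => h2 _,
    ← Finset.sum_neg_distrib]
  refine Finset.sum_congr rfl fun l _ => ?_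
  -- No boundary terms arise on the whole plane: all three products are integrable because `φ` has
  -- compact support, although the polynomials are unbounded.
  rw [integral_mul_fderiv_eq_neg_fderiv_mul_of_integrable (by simpa only [fderiv_ev] using h2 _)
    (h1 l) (h2 _) (fun x _ => differentiable_ev _ x)
    (fun x _ => hφ.differentiable (by simp) x)]
  simp only [fderiv_ev]

/-! ### Degrees -/

lemma mem_P_iff {m : ℕ} {q : Poly} : q ∈ P m ↔ ∀ s ∈ q.support, s.degree ≤ m := by
  rw [P, MvPolynomial.mem_restrictTotalDegree, MvPolynomial.totalDegree, Finset.sup_le_iff]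
  rfl

/-- A monomial of the derivative comes from one of degree one higher. For `m = 0` there is no such
monomial, so the truncated subtraction is harmless. -/
lemma pderiv_mem_P {m : ℕ} {q : Poly} (l : Fin 2) (hq : q ∈ P m) :
    MvPolynomial.pderiv l q ∈ P (m - 1) := by
  rw [mem_P_iff] at hq ⊢
  intro s hs
  rw [MvPolynomial.mem_support_iff, MvPolynomial.coeff_pderiv] at hs
  have := hq _ (MvPolynomial.mem_support_iff.2 (left_ne_zero_of_mul hs))
  simp only [map_add, Finsupp.degree_single] at this
  omega

/-- The operator `X_l ∂_l` multiplies each monomial by its exponent in `X_l`, so the support cannot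
grow. This handles the `x P_k` part of `RT_k`, where counting the two factors separately would fail
for `m = 0`. -/
lemma X_mul_pderiv_mem_P {m : ℕ} {q : Poly} (l : Fin 2) (hq : q ∈ P m) :
    MvPolynomial.X l * MvPolynomial.pderiv l q ∈ P m := by
  rw [q.as_sum, map_sum, Finset.mul_sum]
  refine Submodule.sum_mem _ fun s hs => ?_
  rw [MvPolynomial.X_mul_pderiv_monomial, mem_P_iff]
  intro t ht
  have := MvPolynomial.support_smul ht
  rw [Finset.mem_singleton.1 (MvPolynomial.support_monomial_subset this)]
  exact mem_P_iff.1 hq s hs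

lemma P_mono {m n : ℕ} (h : m ≤ n) {q : Poly} (hq : q ∈ P m) : q ∈ P n :=
  mem_P_iff.2 fun s hs => (mem_P_iff.1 hq s hs).trans h

lemma C_mem_P (m : ℕ) (c : ℝ) : (MvPolynomial.C c : Poly) ∈ P m := by
  rw [P, MvPolynomial.mem_restrictTotalDegree]
  simp

/-- The divergence maps the local velocity space into the local pressure space. -/
lemma pdiv_mem_P (fam : Family) (k : ℕ) {v : VecPoly} (hv : v ∈ fam.localSpace k) :
    pdiv v ∈ P (fam.pressureDegree k) := by
  refine Submodule.sum_mem _ fun l _ => ?_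
  cases fam with
  | BDM => exact pderiv_mem_P l (hv l)
  | RT =>
    obtain ⟨a, ha, b, hb, h⟩ := hv
    rw [h l, map_add, MvPolynomial.pderiv_mul, MvPolynomial.pderiv_X_self, one_mul]
    exact add_mem (P_mono (Nat.sub_le _ _) (pderiv_mem_P l (ha l)))
      (add_mem hb (X_mul_pderiv_mem_P l hb))

/-! ### The mesh -/

lemma isBounded_hull (T : Finset Plane) : Bornology.IsBounded (hull T) :=
  isBounded_convexHull.2 T.finite_toSet.isBounded

lemma measurableSet_interior_hull (T : Finset Plane) : MeasurableSet (interior (hull T)) :=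
  isOpen_interior.measurableSet

variable {M : BackgroundMesh G} {i : Fin 2} {T T' : Finset Plane}

lemma mem_elements_iff : T ∈ M.elements ↔ T ∈ M.complex.faces ∧ T.card = 3 := by
  simp [BackgroundMesh.elements]

lemma mem_active_iff :
    T ∈ M.active i ↔ T ∈ M.elements ∧ (hull T ∩ G.sub i).Nonempty := by
  simp [BackgroundMesh.active]

lemma interior_hull_nonempty_iff (h : AffineIndependent ℝ ((↑) : T → Plane)) :
    (interior (hull T)).Nonempty ↔ T.card = 3 := by
  have h2 := h.affineSpan_eq_top_iff_card_eq_finrank_add_one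
  rw [hull, interior_convexHull_nonempty_iff_affineSpan_eq_top]
  simpa using h2

lemma interior_hull_nonempty (hT : T ∈ M.elements) : (interior (hull T)).Nonempty :=
  (interior_hull_nonempty_iff (M.complex.indep (mem_elements_iff.1 hT).1)).2
    (mem_elements_iff.1 hT).2

/-- Conformity puts the overlap of two triangles inside the hull of their common vertices. If that
hull has interior points there are three common vertices, and the triangles coincide. -/
lemma disjoint_interior_hull (hT : T ∈ M.elements) (hT' : T' ∈ M.elements) (h : T ≠ T') :
    Disjoint (interior (hull T)) (interior (hull T')) := by
  classical
  rw [mem_elements_iff] at hT hT'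
  rw [Set.disjoint_iff_inter_eq_empty, ← interior_inter, ← Set.not_nonempty_iff_eq_empty]
  intro hne
  have hsub : hull T ∩ hull T' ⊆ hull (T ∩ T') := by
    simpa [hull] using M.complex.inter_subset_convexHull hT.1 hT'.1
  have hind : AffineIndependent ℝ ((↑) : (T ∩ T' : Finset Plane) → Plane) :=
    (M.complex.indep hT.1).mono (t := (T : Set Plane))
      (s := ((T ∩ T' : Finset Plane) : Set Plane))
      (by simp)
  have hcard := (interior_hull_nonempty_iff hind).1 (hne.mono (interior_mono hsub))
  have h1 := Finset.eq_of_subset_of_card_le (Finset.inter_subset_left (s₁ := T) (s₂ := T'))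
    (by omega)
  have h2 := Finset.eq_of_subset_of_card_le (Finset.inter_subset_right (s₁ := T) (s₂ := T'))
    (by omega)
  exact h (h1.symm.trans h2)

lemma mem_elements_of_mem_active (hT : T ∈ M.active i) : T ∈ M.elements :=
  (mem_active_iff.1 hT).1

/-- Every active element has interior points in the subdomain. -/
lemma interior_hull_inter_sub_nonempty (hT : T ∈ M.active i) :
    (interior (hull T) ∩ G.sub i).Nonempty := by
  obtain ⟨hel, x, hx, hxi⟩ := mem_active_iff.1 hT
  -- The given point of the subdomain may lie on the boundary of `T`. A convex set with nonempty
  -- interior lies in the closure of that interior, and the subdomain is open, so the point can be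
  -- moved inside.
  have hcl : x ∈ closure (interior (hull T)) := by
    rw [hull, (convex_convexHull ℝ _).closure_interior_eq_closure_of_nonempty_interior
      (interior_hull_nonempty hel)]
    exact subset_closure hx
  obtain ⟨y, hy⟩ := mem_closure_iff.1 hcl _ (G.isOpen_sub i) hxi
  exact ⟨y, hy.2, hy.1⟩

lemma sub_subset_activeDomain (M : BackgroundMesh G) (i : Fin 2) :
    G.sub i ⊆ M.activeDomain i := by
  intro x hx
  have hΩ : x ∈ G.Ω := by
    rw [← G.union_eq]
    fin_cases i
    · exact Or.inl (Or.inl hx)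
    · exact Or.inl (Or.inr hx)
  obtain ⟨s, hs, hxs⟩ := Geometry.SimplicialComplex.mem_space_iff.1 (M.covers hΩ)
  obtain ⟨t, ht, hst, hcard⟩ := M.pure s hs
  have hxt : x ∈ hull t := convexHull_mono (Finset.coe_subset.2 hst) hxs
  exact Set.mem_biUnion (mem_active_iff.2 ⟨mem_elements_iff.2 ⟨ht, hcard⟩, x, hxt, hx⟩) hxt

/-- Almost every point of the active domain is in the interior of an active element. -/
lemma ae_mem_interior_hull (M : BackgroundMesh G) (i : Fin 2) :
    ∀ᵐ x : Plane, x ∈ M.activeDomain i → ∃ T ∈ M.active i, x ∈ interior (hull T) := by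
  have h : ∀ᵐ x : Plane, ∀ T ∈ M.active i, x ∉ frontier (hull T) := by
    rw [Filter.eventually_all_finset]
    intro T _
    exact measure_eq_zero_iff_ae_notMem.1 ((convex_convexHull ℝ _).addHaar_frontier volume)
  filter_upwards [h] with x hx hxa
  obtain ⟨T, hT, hxT⟩ := Set.mem_iUnion₂.1 hxa
  refine ⟨T, hT, ?_⟩
  by_contra hn
  exact hx T hT ⟨subset_closure hxT, hn⟩

lemma isBounded_activeDomain (M : BackgroundMesh G) (i : Fin 2) :
    Bornology.IsBounded (M.activeDomain i) :=
  (Bornology.isBounded_biUnion_finset _).2 fun T _ => isBounded_hull T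

lemma interior_hull_subset_interior_activeDomain (hT : T ∈ M.active i) :
    interior (hull T) ⊆ interior (M.activeDomain i) :=
  interior_mono (Set.subset_biUnion_of_mem (u := fun T => hull T) hT)

lemma fn_of_mem_interior (q : BrokenPair) (hT : T ∈ M.active i) {x : Plane}
    (hx : x ∈ interior (hull T)) : M.fn q i x = ev (q i T) x := by
  rw [BackgroundMesh.fn, Finset.sum_eq_single_of_mem T hT, Set.indicator_of_mem hx]
  intro T' hT' hne
  refine Set.indicator_of_notMem (fun hx' => ?_) _
  exact Set.disjoint_left.1 (disjoint_interior_hull (mem_elements_of_mem_active hT')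
    (mem_elements_of_mem_active hT) hne) hx' hx

lemma vfn_of_mem_interior (v : BrokenVecPair) (hT : T ∈ M.active i) {x : Plane}
    (hx : x ∈ interior (hull T)) : M.vfn v i x = vev (v i T) x := by
  rw [BackgroundMesh.vfn, Finset.sum_eq_single_of_mem T hT, Set.indicator_of_mem hx]
  intro T' hT' hne
  refine Set.indicator_of_notMem (fun hx' => ?_) _
  exact Set.disjoint_left.1 (disjoint_interior_hull (mem_elements_of_mem_active hT')
    (mem_elements_of_mem_active hT) hne) hx' hx

lemma memLp_fn (M : BackgroundMesh G) (q : BrokenPair) (i : Fin 2) :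
    MemLp (M.fn q i) 2 := by
  refine memLp_finsetSum _ fun T _ => ?_
  rw [memLp_indicator_iff_restrict (measurableSet_interior_hull T)]
  have hfin : IsFiniteMeasure (volume.restrict (interior (hull T))) :=
    isFiniteMeasure_restrict.2
      ((isBounded_hull T).subset interior_subset).measure_lt_top.ne
  obtain ⟨C, hC⟩ := (isBounded_hull T).isCompact_closure.exists_bound_of_continuousOn
    (continuous_ev (q i T)).continuousOn
  refine MemLp.of_bound (continuous_ev _).aestronglyMeasurable C ?_
  filter_upwards [ae_restrict_mem (measurableSet_interior_hull T)] with x hx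
  exact hC x (subset_closure (interior_subset hx))

/-! ### Testing with zero velocity -/

@[simp] lemma vev_zero (x : Plane) : vev 0 x = 0 := by
  ext l
  simp [vev]

@[simp] lemma brokenDiv_zero : brokenDiv 0 = 0 := by
  funext i T
  simp [brokenDiv, pdiv]

@[simp] lemma fn_zero : M.fn 0 = 0 := by
  funext i x
  refine Finset.sum_eq_zero fun T _ => ?_
  simp

@[simp] lemma vfn_zero : M.vfn 0 = 0 := by
  funext i x
  refine Finset.sum_eq_zero fun T _ => ?_
  simp

lemma zero_mem_velocitySpace (M : BackgroundMesh G) (fam : Family) (k : ℕ) :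
    0 ∈ velocitySpace M fam k := by
  refine fun i => ⟨fun T _ => ?_, fun T _ => rfl, ?_⟩
  · cases fam with
    | BDM => exact fun l => zero_mem _
    | RT => exact ⟨0, fun l => zero_mem _, 0, zero_mem _, fun l => by simp⟩
  · rw [vfn_zero]
    exact ⟨MemLp.zero, 0, MemLp.zero, fun φ _ _ _ => by simp⟩

@[simp] lemma interfaceTrace_zero (x : Plane) : interfaceTrace M 0 i x = 0 := by
  simp [interfaceTrace]

@[simp] lemma boundaryNormalTrace_zero (x : Plane) : boundaryNormalTrace M 0 x = 0 := by
  simp [boundaryNormalTrace]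

@[simp] lemma faceJump_zero (F : Finset Plane) : faceJump M 0 i F = 0 := by
  simp [faceJump]

@[simp] lemma dirDeriv_zero (ν : Plane) : dirDeriv ν 0 = 0 := by
  simp [dirDeriv]

lemma partialDeriv_zero {j : ℕ} (s : Fin j → Fin 2) : partialDeriv s 0 = 0 := by
  rw [partialDeriv]
  induction List.ofFn s with
  | nil => rfl
  | cons l t ih => rw [List.foldr_cons, ih, map_zero]

lemma normalJumpProduct_zero_right (q : BrokenPair) (F : Finset Plane) (j : ℕ) :
    normalJumpProduct M q 0 i F j = 0 := by
  simp [normalJumpProduct, Function.iterate_fixed (dirDeriv_zero _)]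

lemma jumpProduct_zero_left (S : MethodParams M) (q : BrokenPair) (F : Finset Plane) (j : ℕ) :
    jumpProduct M S 0 q i F j = 0 := by
  rw [jumpProduct]
  cases S.deriv with
  | normal => simp [normalJumpProduct, Function.iterate_fixed (dirDeriv_zero _)]
  | full => simp [fullJumpProduct, partialDeriv_zero]

lemma AForm_zero_right (D : DarcyData G) (S : MethodParams M) (m : ℕ) (u : BrokenVecPair) :
    AForm M D S m u 0 = 0 := by
  -- The penalty `s_u` sees the zero velocity only through its scalar components, each of which is
  -- definitionally the zero pair.
  have h : ∀ (l i : Fin 2) (F : Finset Plane) (j : ℕ),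
      normalJumpProduct M (fun i T => u i T l) (fun i T => (0 : BrokenVecPair) i T l) i F j = 0 :=
    fun l i F j => normalJumpProduct_zero_right _ F j
  simp only [AForm, sU, h, aForm]
  simp [avgNormal, jumpNormal]

lemma BForm_zero_left (D : DarcyData G) (S : MethodParams M) (m : ℕ) (p : BrokenPair) :
    BForm M D S m 0 p = 0 := by
  simp [BForm, bForm, b0Form, sB, jumpProduct_zero_left]

lemma sub_subset_subUnion (G : Geometry) (i : Fin 2) : G.sub i ⊆ G.subUnion := by
  fin_cases i
  · exact Set.subset_union_left
  · exact Set.subset_union_right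

lemma F0Form_zero_left (D : DarcyData G) (S : MethodParams M)
    (hg : ∀ᵐ x ∂(volume.restrict G.subUnion), D.g x = 0) (q : BrokenPair) :
    F0Form M D S 0 q = 0 := by
  -- The flux datum is an arbitrary linear functional, so its argument has to be the zero function
  -- everywhere, not just almost everywhere.
  have h1 : (fun x : D.bdryU => lam M S x * boundaryNormalTrace M 0 x) = 0 := by
    funext x
    simp
  have h2 : ∀ i, ∫ x in G.sub i, D.g x * M.fn q i x = 0 := fun i => by
    refine integral_eq_zero_of_ae ?_
    filter_upwards [ae_restrict_of_ae_restrict_of_subset (sub_subset_subUnion G i) hg] with x hx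
    simp [hx]
  rw [F0Form, h1, map_zero]
  simp [jumpNormal, h2]

lemma SolvesMethodTwo.B0Form_eq_zero {D : DarcyData G} {S : MethodParams M} {m : ℕ}
    {fam : Family} {k : ℕ} {Q : Set BrokenPair} {u : BrokenVecPair} {p : BrokenPair}
    (h : SolvesMethodTwo M D S m (velocitySpace M fam k) Q u p)
    (hg : ∀ᵐ x ∂(volume.restrict G.subUnion), D.g x = 0) {q : BrokenPair} (hq : q ∈ Q) :
    B0Form M S m u q = 0 := by
  have := h.2.2 0 (zero_mem_velocitySpace M fam k) q hq
  rw [AForm_zero_right, BForm_zero_left, F0Form_zero_left D S hg] at this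
  linarith

/-! ### The shifted divergence as a test function -/

open Classical in
/-- The broken polynomial `div u - c`. -/
def shiftedDiv (M : BackgroundMesh G) (u : BrokenVecPair) (c : ℝ) : BrokenPair :=
  fun i T => if T ∈ M.active i then pdiv (u i T) - MvPolynomial.C c else 0

lemma shiftedDiv_of_mem (u : BrokenVecPair) (c : ℝ) (hT : T ∈ M.active i) :
    shiftedDiv M u c i T = pdiv (u i T) - MvPolynomial.C c := if_pos hT

lemma shiftedDiv_mem_pressureSpace {fam : Family} {k : ℕ} {u : BrokenVecPair}
    (hu : u ∈ velocitySpace M fam k) (c : ℝ) :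
    shiftedDiv M u c ∈ pressureSpace M (fam.pressureDegree k) := by
  refine fun i => ⟨fun T hT => ?_, fun T hT => if_neg hT⟩
  rw [shiftedDiv_of_mem u c hT]
  exact sub_mem (pdiv_mem_P fam k ((hu i).1 T hT)) (C_mem_P _ c)

/-- Both neighbours of a ghost face are active, so the same constant is subtracted on either side
and cancels in the jump. -/
lemma faceJump_shiftedDiv (u : BrokenVecPair) (c : ℝ) {F : Finset Plane}
    (hF : F ∈ M.ghostFaces i) :
    faceJump M (shiftedDiv M u c) i F = faceJump M (brokenDiv u) i F := by
  have h : M.SharedBy i F (M.neighbours i F) :=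
    Classical.epsilon_spec (by
      simp only [BackgroundMesh.ghostFaces, Finset.mem_filter] at hF
      exact hF.2.2.2)
  rw [faceJump, shiftedDiv_of_mem u c h.1, shiftedDiv_of_mem u c h.2.1, faceJump]
  simp [brokenDiv]

lemma sB_shiftedDiv_nonneg (S : MethodParams M) (m : ℕ) (u : BrokenVecPair) (c : ℝ) :
    0 ≤ sB M S m u (shiftedDiv M u c) := by
  refine Finset.sum_nonneg fun i _ => Finset.sum_nonneg fun F hF => Finset.sum_nonneg fun j _ => ?_
  -- The exponent `2j + γ` is real and may be negative; a nonnegative base is enough for a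
  -- nonnegative power.
  have hh : 0 ≤ S.hF F := by
    obtain ⟨T, _, _, _, _, _, h, _⟩ := S.hF_between i F hF
    exact Metric.diam_nonneg.trans h
  refine mul_nonneg (mul_nonneg (S.τb_pos i j).le (Real.rpow_nonneg hh _)) ?_
  rw [jumpProduct]
  cases S.deriv with
  | normal =>
    simp only [normalJumpProduct, faceJump_shiftedDiv u c hF]
    exact integral_nonneg fun x => mul_self_nonneg _
  | full =>
    simp only [fullJumpProduct, faceJump_shiftedDiv u c hF]
    exact Finset.sum_nonneg fun s _ => integral_nonneg fun x => mul_self_nonneg _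

lemma ae_fn_shiftedDiv (M : BackgroundMesh G) (u : BrokenVecPair) (c : ℝ) (i : Fin 2) :
    ∀ᵐ x ∂(volume.restrict (G.sub i)),
      M.fn (shiftedDiv M u c) i x = M.fn (brokenDiv u) i x - c := by
  filter_upwards [ae_restrict_of_ae (ae_mem_interior_hull M i),
    ae_restrict_mem (G.isOpen_sub i).measurableSet] with x hx hxi
  obtain ⟨T, hT, hxT⟩ := hx (sub_subset_activeDomain M i hxi)
  rw [fn_of_mem_interior _ hT hxT, fn_of_mem_interior _ hT hxT, shiftedDiv_of_mem u c hT]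
  simp [brokenDiv]

lemma sub_subset_Ω (G : Geometry) (i : Fin 2) : G.sub i ⊆ G.Ω :=
  (sub_subset_subUnion G i).trans (by rw [← G.union_eq]; exact Set.subset_union_left)

instance isFiniteMeasure_restrict_sub (G : Geometry) (i : Fin 2) :
    IsFiniteMeasure (volume.restrict (G.sub i)) :=
  isFiniteMeasure_restrict.2 (G.bounded_Ω.subset (sub_subset_Ω G i)).measure_lt_top.ne

lemma integrableOn_fn (M : BackgroundMesh G) (q : BrokenPair) (i : Fin 2) :
    IntegrableOn (M.fn q i) (G.sub i) :=
  ((memLp_fn M q i).mono_measure Measure.restrict_le_self).integrable (by norm_num)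

lemma integrableOn_fn_mul_fn (M : BackgroundMesh G) (q r : BrokenPair) (i : Fin 2) :
    IntegrableOn (fun x => M.fn q i x * M.fn r i x) (G.sub i) :=
  ((memLp_fn M q i).integrable_mul (memLp_fn M r i)).integrableOn

lemma sum_volume_real_sub (G : Geometry) :
    ∑ i, volume.real (G.sub i) = volume.real G.subUnion := by
  rw [Fin.sum_univ_two, Geometry.subUnion, measureReal_union G.disjoint_sub
    (G.isOpen_sub 1).measurableSet (G.bounded_Ω.subset (sub_subset_Ω G 0)).measure_lt_top.ne
    (G.bounded_Ω.subset (sub_subset_Ω G 1)).measure_lt_top.ne]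

/-- Needed to divide by the area when forming the mean: a connected open subdomain is nonempty,
hence has positive measure. -/
lemma volume_real_subUnion_ne_zero (G : Geometry) : volume.real G.subUnion ≠ 0 := by
  refine (ENNReal.toReal_pos ?_ ?_).ne'
  · exact (((G.isOpen_sub 0).union (G.isOpen_sub 1)).measure_pos volume
      ((G.isConnected_sub 0).nonempty.mono Set.subset_union_left)).ne'
  · exact (G.bounded_Ω.subset (Set.union_subset (sub_subset_Ω G 0)
      (sub_subset_Ω G 1))).measure_lt_top.ne

lemma total_shiftedDiv (M : BackgroundMesh G) (u : BrokenVecPair) (c : ℝ) :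
    total M (shiftedDiv M u c) = total M (brokenDiv u) - c * volume.real G.subUnion := by
  rw [← sum_volume_real_sub, Finset.mul_sum, total, total, ← Finset.sum_sub_distrib]
  refine Finset.sum_congr rfl fun i _ => ?_
  rw [integral_congr_ae (ae_fn_shiftedDiv M u c i),
    integral_sub (integrableOn_fn M _ i) (integrable_const c)]
  simp [mul_comm]

/-- If `div u - c` is an admissible test function and orthogonal to the constant `c`, then
`div u = c` at every point of every active element. -/
lemma ev_pdiv_eq_of_B0Form_eq_zero {S : MethodParams M} {m : ℕ} {u : BrokenVecPair} {c : ℝ}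
    (h : B0Form M S m u (shiftedDiv M u c) = 0) (hc : c * total M (shiftedDiv M u c) = 0)
    (hT : T ∈ M.active i) (x : Plane) : ev (pdiv (u i T)) x = c := by
  set q := shiftedDiv M u c with hq
  -- Substitute `div u = q + c` in the first factor.
  have hsplit : ∀ i, ∫ x in G.sub i, M.fn (brokenDiv u) i x * M.fn q i x =
      (∫ x in G.sub i, M.fn q i x * M.fn q i x) + c * ∫ x in G.sub i, M.fn q i x := fun i => by
    rw [← integral_const_mul, ← integral_add (integrableOn_fn_mul_fn M q q i)
      ((integrableOn_fn M q i).const_mul c)]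
    refine integral_congr_ae ?_
    filter_upwards [ae_fn_shiftedDiv M u c i] with x hx
    rw [← hq] at hx
    rw [show M.fn (brokenDiv u) i x = M.fn q i x + c by linarith]
    ring
  have hnonneg : ∀ i, 0 ≤ ∫ x in G.sub i, M.fn q i x * M.fn q i x := fun i =>
    integral_nonneg fun x => mul_self_nonneg _
  -- By `h` and `hc`, the squared norm of `q` is minus the ghost penalty, so it is both nonpositive
  -- and nonnegative.
  have hsum : ∑ i, ∫ x in G.sub i, M.fn q i x * M.fn q i x = 0 := by
    have h1 := sB_shiftedDiv_nonneg S m u c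
    have h2 := Finset.sum_nonneg fun i (_ : i ∈ Finset.univ) => hnonneg i
    rw [B0Form, b0Form, Finset.sum_congr rfl fun i _ => hsplit i, Finset.sum_add_distrib,
      ← Finset.mul_sum] at h
    rw [total] at hc
    linarith
  have hzero := (Finset.sum_eq_zero_iff_of_nonneg fun i _ => hnonneg i).1 hsum i (Finset.mem_univ i)
  rw [integral_eq_zero_iff_of_nonneg (fun x => mul_self_nonneg _)
    (integrableOn_fn_mul_fn M q q i)] at hzero
  have hopen : IsOpen (interior (hull T) ∩ G.sub i) := isOpen_interior.inter (G.isOpen_sub i)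
  have hae : ev (q i T) =ᵐ[volume.restrict (interior (hull T) ∩ G.sub i)] fun _ => 0 := by
    filter_upwards [ae_restrict_of_ae_restrict_of_subset Set.inter_subset_right hzero,
      ae_restrict_mem hopen.measurableSet] with x hx hxm
    rw [← fn_of_mem_interior q hT hxm.1]
    exact mul_self_eq_zero.1 hx
  -- Continuity turns the almost everywhere statement into a pointwise one on the open set;
  -- analyticity carries it to the part of `T` outside the subdomain.
  have := ev_eq_zero_of_eqOn_open (q i T) hopen (interior_hull_inter_sub_nonempty hT)
    (Measure.eqOn_open_of_ae_eq hae hopen (continuous_ev _).continuousOn continuousOn_const) x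
  rw [hq, shiftedDiv_of_mem u c hT, ev_sub, ev_C] at this
  linarith

/-! ### The divergence in the sense of distributions -/

/-- If the elementwise divergence of an `H^div` field is the constant `c`, so is its weak
divergence. -/
lemma isWeakDiv_const {u : BrokenVecPair} {c : ℝ}
    (hu : MemHdiv (interior (M.activeDomain i)) (M.vfn u i))
    (hdiv : ∀ T ∈ M.active i, ∀ x, ev (pdiv (u i T)) x = c) :
    IsWeakDiv (interior (M.activeDomain i)) (M.vfn u i) fun _ => c := by
  set U := interior (M.activeDomain i) with hU
  obtain ⟨-, d, hd, hweak⟩ := hu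
  have hfin : IsFiniteMeasure (volume.restrict U) := isFiniteMeasure_restrict.2
    ((isBounded_activeDomain M i).subset interior_subset).measure_lt_top.ne
  have hdint : IntegrableOn d U := hd.integrable (by norm_num)
  -- Fundamental lemma of the calculus of variations on a single open element: test functions
  -- supported there see only one polynomial, whose classical divergence is `c`.
  have hlocal : ∀ T ∈ M.active i, ∀ᵐ x : Plane, x ∈ interior (hull T) → d x - c = 0 := by
    intro T hT
    have hTU : interior (hull T) ⊆ U := interior_hull_subset_interior_activeDomain hT
    refine isOpen_interior.ae_eq_zero_of_integral_contDiff_smul_eq_zero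
      (IntegrableOn.locallyIntegrableOn
        ((hdint.sub (integrable_const c)).mono_set hTU)) fun φ hφ hc hsupp => ?_
    have hφ0 : ∀ x ∉ interior (hull T), φ x = 0 := fun x hx =>
      image_eq_zero_of_notMem_tsupport fun h => hx (hsupp h)
    have hgrad : ∀ x ∉ interior (hull T), gradient φ x = 0 := fun x hx => by
      have : fderiv ℝ φ x = 0 := image_eq_zero_of_notMem_tsupport
        fun h => hx (hsupp (tsupport_fderiv_subset ℝ h))
      rw [gradient, this, map_zero]
    have h1 : ∫ x in U, inner ℝ (M.vfn u i x) (gradient φ x) = -∫ x, c * φ x := by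
      have h2 := integral_inner_vev_gradient (u i T) hφ hc
      simp only [hdiv T hT] at h2
      rw [← h2, setIntegral_eq_integral_of_forall_compl_eq_zero
        fun x hx => by rw [hgrad x fun h => hx (hTU h), inner_zero_right]]
      refine integral_congr_ae (ae_of_all _ fun x => ?_)
      by_cases hx : x ∈ interior (hull T)
      · simp only [vfn_of_mem_interior u hT hx]
      · simp only [hgrad x hx, inner_zero_right]
    have h3 := hweak φ hφ hc (hsupp.trans hTU)
    obtain ⟨C, hC⟩ := hc.exists_bound_of_continuous hφ.continuous
    have h4 : Integrable (fun x => d x * φ x) (volume.restrict U) :=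
      hdint.mul_bdd hφ.continuous.aestronglyMeasurable (ae_of_all _ hC)
    have h5 : Integrable (fun x => c * φ x) (volume.restrict U) :=
      ((hφ.continuous.integrable_of_hasCompactSupport hc).const_mul c).integrableOn
    have h6 : ∫ x in U, c * φ x = ∫ x, c * φ x :=
      setIntegral_eq_integral_of_forall_compl_eq_zero
        fun x hx => by rw [hφ0 x fun h => hx (hTU h), mul_zero]
    rw [← setIntegral_eq_integral_of_forall_compl_eq_zero (s := U)
      fun x hx => by rw [hφ0 x fun h => hx (hTU h), zero_smul]]
    have h7 : ∀ x, φ x • (d x - c) = d x * φ x - c * φ x := fun x => by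
      rw [smul_eq_mul]
      ring
    simp only [h7]
    rw [integral_sub h4 h5]
    linarith
  -- Since `d` is a function, agreement off the null set of edges suffices; a normal jump across an
  -- edge would instead have given a singular part.
  have hae : ∀ᵐ x ∂(volume.restrict U), d x = c := by
    filter_upwards [ae_restrict_of_ae (ae_mem_interior_hull M i),
      ae_restrict_of_ae ((Filter.eventually_all_finset _).2 hlocal),
      ae_restrict_mem isOpen_interior.measurableSet] with x hx hl hxU
    obtain ⟨T, hT, hxT⟩ := hx (interior_subset hxU)
    exact sub_eq_zero.1 (hl T hT hxT)
  intro φ hφ hc hsupp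
  rw [hweak φ hφ hc hsupp]
  congr 1
  refine integral_congr_ae ?_
  filter_upwards [hae] with x hx
  rw [hx]

lemma divEq_of_B0Form_eq_zero {S : MethodParams M} {m : ℕ} {fam : Family} {k : ℕ}
    {u : BrokenVecPair} (hu : u ∈ velocitySpace M fam k) {c : ℝ}
    (h : B0Form M S m u (shiftedDiv M u c) = 0) (hc : c * total M (shiftedDiv M u c) = 0) :
    DivEq M u c := fun i =>
  ⟨fun _ hT x _ => ev_pdiv_eq_of_B0Form_eq_zero h hc hT x,
    isWeakDiv_const (hu i).2.2 fun _ hT x => ev_pdiv_eq_of_B0Form_eq_zero h hc hT x⟩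

end CutDarcy
end

theorem mainTheorem1 (G : CutDarcy.Geometry) (M : CutDarcy.BackgroundMesh G)
    (D : CutDarcy.DarcyData G) (S : CutDarcy.MethodParams M)
    (fam : CutDarcy.Family) (k : ℕ) (hk : fam.Admissible k)
    (hg : ∀ᵐ x ∂(MeasureTheory.volume.restrict G.subUnion), D.g x = 0)
    (u : CutDarcy.BrokenVecPair) (p : CutDarcy.BrokenPair) :
    (CutDarcy.SolvesMethodTwo M D S (fam.pressureDegree k) (CutDarcy.velocitySpace M fam k)
        (CutDarcy.pressureSpace M (fam.pressureDegree k)) u p →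
      CutDarcy.DivEq M u 0) ∧
    (D.bdryP = ∅ →
      CutDarcy.SolvesMethodTwo M D S (fam.pressureDegree k) (CutDarcy.velocitySpace M fam k)
        (CutDarcy.zeroMeanPressureSpace M (fam.pressureDegree k)) u p →
      CutDarcy.DivEq M u
        (CutDarcy.total M (CutDarcy.brokenDiv u) / MeasureTheory.volume.real G.subUnion)) := by
  refine ⟨fun h => ?_, fun _ h => ?_⟩
  -- With `c = 0`, the factor `c` alone gives orthogonality; nothing about the mean of `div u` is
  -- required.
  · exact CutDarcy.divEq_of_B0Form_eq_zero h.1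
      (h.B0Form_eq_zero hg (CutDarcy.shiftedDiv_mem_pressureSpace h.1 0)) (zero_mul _)
  -- Here `c` is the mean of `div u`. The zero total of the shifted divergence serves twice: for
  -- membership in the normalised space and for orthogonality to `c`.
  · have hzero : CutDarcy.total M (CutDarcy.shiftedDiv M u (CutDarcy.total M
        (CutDarcy.brokenDiv u) / MeasureTheory.volume.real G.subUnion)) = 0 := by
      rw [CutDarcy.total_shiftedDiv, div_mul_cancel₀ _ (CutDarcy.volume_real_subUnion_ne_zero G),
        sub_self]
    exact CutDarcy.divEq_of_B0Form_eq_zero h.1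
      (h.B0Form_eq_zero hg ⟨CutDarcy.shiftedDiv_mem_pressureSpace h.1 _, hzero⟩)
      (by rw [hzero, mul_zero])
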